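/- **Setting.** Let $G_n$ be chosen uniformly at random among the simple $r$-regular graphs on $n$ labelled vertices $V_n$ ($nr$ even). "With high probability" (w.h.p.) means with probability tending to $1$ as $n\to\infty$ along $n$ with $nr$ even, for fixed $r$. Let $d(x,y)$ be the graph distance, $d=\operatorname{diam}(G_n)$, and $$i(G_n)=\min_{\emptyset\ne A\subset V_n,\ |A|\le n/2}\frac{|\partial_e A|}{|A|},$$ where $\partial_e A$ is the set of edges joining $A$ to its complement. For $\sigma\in\{-1,+1\}^{V_n}$ put $$H(\sigma)=-\sum_{\{x,y\}\subset V_n,\ x\ne y}\mathcal J(d(x,y))\,\sigma_x\sigma_y-h\sum_{x\in V_n}\sigma_x ,$$ each unordered pair being counted once, where either $\mathcal J(i)=Jr^{1-i}$, or $\mathcal J(i)=Ji^{-\lambda}$ with $\lambda>2$. A path from $\sigma$ to $\eta$ is a finite sequence of configurations in which consecutive ones differ by one spin flip; $\Phi(\sigma,\eta)$ is the minimum over all paths from $\sigma$ to $\eta$ of the maximum of $H$ along the path. The stability level of $\sigma$ is $$V_\sigma=\min_{\eta:\,H(\eta)<H(\sigma)}\Phi(\sigma,\eta)-H(\sigma),$$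 with $V_\sigma=\infty$ if no such $\eta$ exists. Let $\mathbf{-1}$ be the configuration with all spins equal to $-1$. **Condition 1.** $r\ge 3$, $n>\max\{r^r,\ r^2J/h\}$, $h>0$ and $J\ge\max\{1,\ h/i(G_n)\}$ (where $h/0=+\infty$). Let $$f(r,\lambda)=\begin{cases} r & \text{if }\mathcal J(i)=Jr^{1-i},\\ r-2 & \text{if }\mathcal J(i)=Ji^{-\lambda}\text{ and }\lambda\ge d,\\ \zeta(\lambda)(r-1)^d & \text{if }\mathcal J(i)=Ji^{-\lambda}\text{ and }\lambda<d.\end{cases}$$ **Proposition (Estimate of $V_{\mathbf{-1}}$).** There are functions $\varepsilon_l,\varepsilon_u:\mathbb N\to\mathbb R$ with $\varepsilon_l(r)=o(r)$ and $\varepsilon_u(r)=o(r)$ as $r\to\infty$ such that, for every integer $r\ge3$, w.h.p. the following holds for both kinds of interaction, for all $\lambda>2$ and all real $J,h$ for which Condition 1 holds: 1. (lower bound) if $h<JC\sqrt r$ for some constant $0<C<\frac{\sqrt3}{2}-\sqrt{\log 2}$, then $V_{\mathbf{-1}}\ \ge\ \Gamma_l:=J\left(\frac r2-\varepsilon_l(r)\right)n$;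 2. (upper bound) $V_{\mathbf{-1}}\ \le\ \Gamma_u:=J\left(r f(r,\lambda)+\varepsilon_u(r)\right)n$. -/

import Mathlib

/-! ### Random regular graphs -/

/-- The set of all simple `r`-regular graphs with vertex set `Fin n`. -/
def regularGraphs (n r : ℕ) : Set (SimpleGraph (Fin n)) :=
  {G | ∀ v, (G.neighborSet v).ncard = r}

/-- The probability that a graph drawn uniformly at random from the simple `r`-regular graphs
on `n` vertices has the property `P`. -/
noncomputable def regularGraphProb (n r : ℕ) (P : SimpleGraph (Fin n) → Prop) : ℝ :=
  ({G | G ∈ regularGraphs n r ∧ P G}.ncard : ℝ) / ((regularGraphs n r).ncard : ℝ)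

/-- The random `r`-regular graph has the property `P` with high probability: the probability
tends to `1` as `n → ∞` along those `n` for which `n * r` is even (for other `n` there are no
`r`-regular graphs on `n` vertices). -/
def WithHighProbability (r : ℕ) (P : ∀ n : ℕ, SimpleGraph (Fin n) → Prop) : Prop :=
  Filter.Tendsto (fun n : ℕ => regularGraphProb n r (P n))
    (Filter.atTop ⊓ Filter.principal {n : ℕ | Even (n * r)}) (nhds 1)

/-- The edge boundary of `A`: each edge joining `A` and its complement is listed once, as the
ordered pair whose first entry lies in `A`. -/
def edgeBoundary {n : ℕ} (G : SimpleGraph (Fin n)) (A : Finset (Fin n)) : Set (Fin n × Fin n) :=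
  {p | p.1 ∈ A ∧ p.2 ∉ A ∧ G.Adj p.1 p.2}

/-- The isoperimetric number (edge Cheeger constant): the minimum of `|∂A| / |A|` over the
nonempty sets `A` of at most `n / 2` vertices. -/
noncomputable def isoperimetricNumber {n : ℕ} (G : SimpleGraph (Fin n)) : ℝ :=
  ⨅ A : {A : Finset (Fin n) // A.Nonempty ∧ 2 * A.card ≤ n},
    ((edgeBoundary G A.1).ncard : ℝ) / (A.1.card : ℝ)

/-! ### The long-range Ising model -/

/-- Spin configurations: `ℤˣ = {1, -1}`. -/
abbrev Config (n : ℕ) : Type := Fin n → ℤˣ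

/-- The homogeneous configuration with all spins equal to `-1`. -/
def allMinus (n : ℕ) : Config n := fun _ => -1

/-- The two families of interactions considered. -/
inductive Interaction where
  | exponential : Interaction
  | polynomial (lam : ℝ) : Interaction

/-- The decay exponent of a polynomial interaction is larger than `2`. -/
def Interaction.Admissible : Interaction → Prop
  | .exponential => True
  | .polynomial lam => 2 < lam

/-- The coupling of two spins at graph distance `i`: `J r^(1-i)`, respectively `J i^(-lam)`. -/
noncomputable def Interaction.coupling (I : Interaction) (r : ℕ) (J : ℝ) (i : ℕ) : ℝ :=
  match I with
  | .exponential => J * (r : ℝ) ^ (1 - (i : ℤ))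
  | .polynomial lam => J * (i : ℝ) ^ (-lam)

/-- The Hamiltonian with pair coupling `K` and external field `h`. Every unordered pair of
distinct vertices contributes once. -/
noncomputable def hamiltonian {n : ℕ} (G : SimpleGraph (Fin n)) (K : ℕ → ℝ) (h : ℝ)
    (σ : Config n) : ℝ :=
  -(∑ x : Fin n, ∑ y ∈ Finset.Ioi x, K (G.dist x y) * ((σ x : ℤ) : ℝ) * ((σ y : ℤ) : ℝ))
    - h * ∑ x : Fin n, ((σ x : ℤ) : ℝ)

/-! ### Stability levels -/

/-- Two configurations are adjacent if one is obtained from the other by a single spin flip. -/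
def spinFlipGraph (n : ℕ) : SimpleGraph (Config n) where
  Adj σ η := ∃ x, η = Function.update σ x (-σ x)
  symm := ⟨by
    rintro σ η ⟨x, rfl⟩
    exact ⟨x, by simp⟩⟩
  loopless := ⟨by
    rintro σ ⟨x, hx⟩
    have h := congrFun hx x
    rw [Function.update_self] at h
    rcases Int.units_eq_one_or (σ x) with h1 | h1 <;> rw [h1] at h <;> revert h <;> decide⟩

/-- The communication height of `σ` and `η`: the minimum over all single-spin-flip paths from
`σ` to `η` of the maximal energy along the path. -/
noncomputable def communicationHeight {n : ℕ} (H : Config n → ℝ) (σ η : Config n) : EReal :=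
  ⨅ ω : (spinFlipGraph n).Walk σ η, ⨆ ζ ∈ ω.support, (H ζ : EReal)

/-- The stability level of `σ`: the communication height between `σ` and the set of
configurations of strictly lower energy, minus the energy of `σ`. It is `⊤` if there is no
configuration of lower energy. -/
noncomputable def stabilityLevel {n : ℕ} (H : Config n → ℝ) (σ : Config n) : EReal :=
  (⨅ η ∈ {η : Config n | H η < H σ}, communicationHeight H σ η) - (H σ : EReal)

/-! ### Parameters and bounds -/

/-- The standing conditions on the parameters. The last field says `h / i(G) ≤ J` with
`i(G)` the isoperimetric number, and is never satisfied if `i(G) = 0`. -/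
structure ParameterCondition {n : ℕ} (G : SimpleGraph (Fin n)) (r : ℕ) (J h : ℝ) : Prop where
  three_le : 3 ≤ r
  pow_lt : r ^ r < n
  div_lt : (r : ℝ) ^ 2 * J / h < n
  field_pos : 0 < h
  one_le : 1 ≤ J
  field_le : h ≤ J * isoperimetricNumber G

/-- The factor `f` of the upper bound, on a graph of diameter `d`. -/
noncomputable def Interaction.barrierFactor (I : Interaction) (r d : ℕ) : ℝ :=
  match I with
  | .exponential => r
  | .polynomial lam =>
      open Classical in
      if (d : ℝ) ≤ lam then (r : ℝ) - 2 else (riemannZeta (lam : ℂ)).re * ((r : ℝ) - 1) ^ d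

/-! If `A` is the set of plus spins, the energy above `allMinus` is twice the total coupling across
`(A, Aᶜ)` minus `2 * h * |A|`.

Upper bound: this excess is bounded over all configurations, so any path to all-plus will do. The
coupling across the cut is at most `S * min(|A|, |Aᶜ|)`, with `S` a bound on the row sums, so the
excess is at most `S * n`. Spheres have at most `r(r-1)^(i-1)` vertices, which bounds `S` by a
geometric series, by its nearest-neighbour term (`lam ≥ d`, where `d` is large because `n` is), or
by a zeta series.

Lower bound: `h ≤ J * i(G)` forces a configuration below `allMinus` to have more than `n / 2`
pluses, so every path meets a balanced configuration, whose excess is at least `2J|∂A| - hn`. It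
remains to show that w.h.p. all balanced cuts have at least `(r/4 - o(r)) n` edges. Fix `A`.
Switching an edge inside `A` with one outside adds two crossing edges; below `(1-u)rn/4` crossing
edges there are so many more forward than backward switchings that the number of graphs with cut at
most `t` grows by a factor `1 + u` as `t` increases by 2 (`one_add_mul_card_regularGraphsCutLE_le`).
With `u = 4/s`, `s ≈ √(r/2)`, and `sn` iterations, a small cut at `A` has probability at most
`5^(-n)`, which beats the `2^n` choices of `A`. -/

/-! ### Energies relative to the homogeneous configuration -/

/-- The vertices carrying a plus spin. -/
def plusSet {n : ℕ} (σ : Config n) : Finset (Fin n) :=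
  Finset.univ.filter fun x => σ x = 1

lemma mem_plusSet {n : ℕ} {σ : Config n} {x : Fin n} : x ∈ plusSet σ ↔ σ x = 1 := by
  simp [plusSet]

lemma plusSet_allMinus (n : ℕ) : plusSet (allMinus n) = ∅ := by
  ext x
  simp only [mem_plusSet, allMinus, Finset.notMem_empty, iff_false]
  decide

lemma spin_eq_ite {n : ℕ} (σ : Config n) (x : Fin n) :
    ((σ x : ℤ) : ℝ) = 2 * (if x ∈ plusSet σ then 1 else 0) - 1 := by
  rcases Int.units_eq_one_or (σ x) with h | h
  · rw [if_pos (mem_plusSet.2 h), h]; norm_num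
  · have : x ∉ plusSet σ := fun hx => by
      rw [mem_plusSet, h] at hx; revert hx; decide
    rw [if_neg this, h]; norm_num

/-- Relative to `allMinus`, only pairs with opposite spins change their contribution, each by twice
its coupling; each plus spin gains `2h` from the field. -/
lemma hamiltonian_sub_allMinus {n : ℕ} (G : SimpleGraph (Fin n)) (K : ℕ → ℝ) (h : ℝ)
    (σ : Config n) :
    hamiltonian G K h σ - hamiltonian G K h (allMinus n) =
      2 * ∑ x ∈ plusSet σ, ∑ y ∈ (plusSet σ)ᶜ, K (G.dist x y)
        - 2 * h * ((plusSet σ).card : ℝ) := by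
  classical
  set A := plusSet σ with hA
  let g : Fin n → Fin n → ℝ := fun x y => if x ∈ A ∧ y ∉ A then 2 * K (G.dist x y) else 0
  have hfield : ∑ x : Fin n, ((σ x : ℤ) : ℝ) - ∑ x : Fin n, ((allMinus n x : ℤ) : ℝ)
      = 2 * (A.card : ℝ) := by
    rw [← Finset.sum_sub_distrib]
    simp only [spin_eq_ite, plusSet_allMinus, ← hA]
    simp [Finset.sum_ite_mem, mul_comm]
  have hpair : (∑ x : Fin n, ∑ y ∈ Finset.Ioi x,
        K (G.dist x y) * ((allMinus n x : ℤ) : ℝ) * ((allMinus n y : ℤ) : ℝ))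
      - (∑ x : Fin n, ∑ y ∈ Finset.Ioi x, K (G.dist x y) * ((σ x : ℤ) : ℝ) * ((σ y : ℤ) : ℝ))
      = ∑ x : Fin n, ∑ y ∈ Finset.Ioi x, (g y x + g x y) := by
    rw [← Finset.sum_sub_distrib]
    refine Finset.sum_congr rfl fun x _ => ?_
    rw [← Finset.sum_sub_distrib]
    refine Finset.sum_congr rfl fun y _ => ?_
    simp only [spin_eq_ite, plusSet_allMinus, ← hA, g, G.dist_comm (u := y)]
    by_cases hx : x ∈ A <;> by_cases hy : y ∈ A <;> simp [hx, hy] <;> ring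
  have hsum : ∑ x : Fin n, ∑ y ∈ Finset.Ioi x, (g y x + g x y)
      = 2 * ∑ x ∈ A, ∑ y ∈ Aᶜ, K (G.dist x y) := by
    -- `g` charges an ordered pair only when it leaves `A`, so it vanishes on the diagonal and the
    -- unordered sum becomes a full double sum.
    rw [Finset.sum_sum_Ioi_add_eq_sum_sum_off_diag, Finset.mul_sum]
    have h1 : ∀ i : Fin n, ∑ j ∈ {i}ᶜ, g j i = ∑ j, g j i := fun i => by
      refine Finset.sum_subset (Finset.subset_univ _) fun j _ hj => ?_
      have : j = i := by simpa using hj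
      subst this
      simp only [g]
      rw [if_neg fun h => h.2 h.1]
    simp only [h1]
    rw [Finset.sum_comm]
    simp only [g, ite_and]
    rw [← Finset.sum_subset (Finset.subset_univ A)]
    · refine Finset.sum_congr rfl fun x hx => ?_
      rw [Finset.mul_sum]
      simp only [hx, if_true]
      rw [← Finset.sum_filter]
      refine Finset.sum_congr ?_ fun _ _ => rfl
      ext; simp
    · intro x _ hx
      simp [hx]
  unfold hamiltonian
  linear_combination hpair + hsum - h * hfield

/-- A walk of spin flips passes through every intermediate number of plus spins. -/
lemma exists_mem_support_card_plusSet {n m : ℕ} {σ η : Config n}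
    (ω : (spinFlipGraph n).Walk σ η) (h1 : (plusSet σ).card ≤ m) (h2 : m ≤ (plusSet η).card) :
    ∃ ζ ∈ ω.support, (plusSet ζ).card = m := by
  classical
  induction ω with
  | nil => exact ⟨_, by simp, le_antisymm h1 h2⟩
  | @cons u v w huv p ih =>
    rcases h1.eq_or_lt with h | h
    · exact ⟨u, by simp, h⟩
    · have hv : (plusSet v).card ≤ m := by
        obtain ⟨x, rfl⟩ := huv
        have hsub : plusSet (Function.update u x (-u x)) ⊆ insert x (plusSet u) := by
          intro y hy
          rw [mem_plusSet] at hy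
          by_cases hyx : y = x
          · simp [hyx]
          · rw [Function.update_of_ne hyx] at hy
            exact Finset.mem_insert_of_mem (mem_plusSet.2 hy)
        have := (Finset.card_le_card hsub).trans (Finset.card_insert_le _ _)
        omega
      obtain ⟨ζ, hζ, hc⟩ := ih hv h2
      exact ⟨ζ, by simp [hζ], hc⟩

/-! ### Spin-flip paths and criteria for stability levels. -/

lemma spinFlipGraph_reachable {n : ℕ} (σ η : Config n) : (spinFlipGraph n).Reachable σ η := by
  classical
  have key : ∀ s : Finset (Fin n), ∀ σ : Config n, (∀ x, x ∉ s → σ x = η x) →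
      (spinFlipGraph n).Reachable σ η := by
    intro s
    induction s using Finset.induction_on with
    | empty =>
      intro σ h
      rw [funext fun x => h x (by simp)]
    | insert a s ha ih =>
      intro σ h
      by_cases hσ : σ a = η a
      · refine ih σ fun x hx => ?_
        by_cases hxa : x = a
        · rw [hxa, hσ]
        · exact h x (by simp [hxa, hx])
      · have hflip : -σ a = η a := by
          rcases Int.units_eq_one_or (σ a) with h1 | h1 <;>
            rcases Int.units_eq_one_or (η a) with h2 | h2 <;> simp_all
        have hadj : (spinFlipGraph n).Adj σ (Function.update σ a (-σ a)) := ⟨a, rfl⟩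
        refine hadj.reachable.trans (ih _ fun x hx => ?_)
        by_cases hxa : x = a
        · subst hxa; simp [hflip]
        · rw [Function.update_of_ne hxa]
          exact h x (by simp [hxa, hx])
  exact key Finset.univ σ fun x hx => absurd (Finset.mem_univ x) hx

lemma stabilityLevel_le {n : ℕ} {H : Config n → ℝ} {σ η : Config n} {b : ℝ}
    (hη : H η < H σ) (hb : ∀ ζ, H ζ - H σ ≤ b) : stabilityLevel H σ ≤ (b : EReal) := by
  obtain ⟨ω⟩ := spinFlipGraph_reachable σ η
  have h1 : (⨅ η ∈ {η : Config n | H η < H σ}, communicationHeight H σ η)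
      ≤ ((b + H σ : ℝ) : EReal) := by
    refine (iInf₂_le η hη).trans ((iInf_le _ ω).trans (iSup₂_le fun ζ _ => ?_))
    exact EReal.coe_le_coe_iff.2 (by linarith [hb ζ])
  unfold stabilityLevel
  refine (EReal.sub_le_sub h1 le_rfl).trans ?_
  rw [← EReal.coe_sub]
  exact EReal.coe_le_coe_iff.2 (by linarith)

lemma le_stabilityLevel {n : ℕ} {H : Config n → ℝ} {σ : Config n} {b : ℝ}
    (hb : ∀ η, H η < H σ → ∀ ω : (spinFlipGraph n).Walk σ η, ∃ ζ ∈ ω.support, b ≤ H ζ - H σ) :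
    (b : EReal) ≤ stabilityLevel H σ := by
  have h1 : ((b + H σ : ℝ) : EReal)
      ≤ (⨅ η ∈ {η : Config n | H η < H σ}, communicationHeight H σ η) := by
    refine le_iInf₂ fun η hη => le_iInf fun ω => ?_
    obtain ⟨ζ, hζ, hle⟩ := hb η hη ω
    exact (EReal.coe_le_coe_iff.2 (by linarith)).trans
      (le_iSup₂ (f := fun ζ (_ : ζ ∈ ω.support) => (H ζ : EReal)) ζ hζ)
  unfold stabilityLevel
  refine le_trans ?_ (EReal.sub_le_sub h1 le_rfl)
  rw [← EReal.coe_sub]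
  exact EReal.coe_le_coe_iff.2 (by linarith)

/-! ### Consequences of a positive isoperimetric number -/

lemma isoperimetricNumber_mul_card_le {n : ℕ} (G : SimpleGraph (Fin n)) {A : Finset (Fin n)}
    (hA : 2 * A.card ≤ n) :
    isoperimetricNumber G * A.card ≤ (edgeBoundary G A).ncard := by
  rcases A.eq_empty_or_nonempty with rfl | hne
  · simp
  · have hpos : (0 : ℝ) < A.card := by exact_mod_cast hne.card_pos
    rw [← le_div_iff₀ hpos]
    refine ciInf_le ⟨0, ?_⟩ (⟨A, hne, hA⟩ : {A : Finset (Fin n) // A.Nonempty ∧ 2 * A.card ≤ n})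
    rintro _ ⟨B, rfl⟩
    positivity

/-- Otherwise a component or its complement has at most `n / 2` vertices and an empty boundary. -/
lemma connected_of_isoperimetricNumber_pos {n : ℕ} (hn : 0 < n) {G : SimpleGraph (Fin n)}
    (h : 0 < isoperimetricNumber G) : G.Connected := by
  classical
  have : Nonempty (Fin n) := ⟨⟨0, hn⟩⟩
  refine ⟨fun x y => ?_⟩
  by_contra hxy
  let A : Finset (Fin n) := Finset.univ.filter fun z => G.Reachable x z
  have hmem : ∀ z, z ∈ A ↔ G.Reachable x z := fun z => by simp [A]
  have key : ∀ B : Finset (Fin n), B.Nonempty → 2 * B.card ≤ n →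
      edgeBoundary G B = ∅ → False := by
    intro B hB hc he
    have := isoperimetricNumber_mul_card_le G hc
    rw [he, Set.ncard_empty] at this
    have hpos : (0 : ℝ) < B.card := by exact_mod_cast hB.card_pos
    have := mul_pos h hpos
    push_cast at *
    linarith
  have hadj : ∀ u v, G.Adj u v → (u ∈ A ↔ v ∈ A) := fun u v huv => by
    rw [hmem, hmem]
    exact ⟨fun h => h.trans huv.reachable, fun h => h.trans huv.symm.reachable⟩
  by_cases hc : 2 * A.card ≤ n
  · refine key A ⟨x, (hmem x).2 (SimpleGraph.Reachable.refl x)⟩ hc (Set.eq_empty_iff_forall_notMem.2 ?_)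
    rintro ⟨u, v⟩ ⟨hu, hv, huv⟩
    exact hv ((hadj u v huv).1 hu)
  · refine key Aᶜ ⟨y, by simp [hmem, hxy]⟩ ?_ (Set.eq_empty_iff_forall_notMem.2 ?_)
    · rw [Finset.card_compl, Fintype.card_fin]; omega
    · rintro ⟨u, v⟩ ⟨hu, hv, huv⟩
      simp only [Finset.mem_compl, not_not] at hu hv
      exact hu ((hadj u v huv).2 hv)

lemma Interaction.coupling_nonneg (I : Interaction) (r : ℕ) {J : ℝ} (hJ : 0 ≤ J) (i : ℕ) :
    0 ≤ I.coupling r J i := by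
  cases I <;> simp only [Interaction.coupling] <;> positivity

lemma Interaction.coupling_one (I : Interaction) (r : ℕ) (J : ℝ) : I.coupling r J 1 = J := by
  cases I <;> simp [Interaction.coupling]

lemma mul_ncard_edgeBoundary_le {n : ℕ} (G : SimpleGraph (Fin n)) {K : ℕ → ℝ}
    (hK : ∀ i, 0 ≤ K i) (A : Finset (Fin n)) :
    K 1 * (edgeBoundary G A).ncard ≤ ∑ x ∈ A, ∑ y ∈ Aᶜ, K (G.dist x y) := by
  classical
  have hset : edgeBoundary G A = ((A ×ˢ Aᶜ).filter fun p => G.Adj p.1 p.2 : Finset _) := by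
    ext p
    simp [edgeBoundary, and_assoc]
  rw [hset, Set.ncard_coe_finset, ← Finset.sum_product', mul_comm, ← nsmul_eq_mul,
    ← Finset.sum_const]
  refine (Finset.sum_le_sum (g := fun p => K (G.dist p.1 p.2)) fun p hp => ?_).trans
    (Finset.sum_le_sum_of_subset_of_nonneg (Finset.filter_subset _ _) fun p _ _ => hK _)
  rw [SimpleGraph.dist_eq_one_iff_adj.2 (Finset.mem_filter.1 hp).2]

/-- If all balanced bipartitions have large boundary, then the energy barrier is high. -/
lemma le_stabilityLevel_allMinus {n r : ℕ} {G : SimpleGraph (Fin n)} {I : Interaction} {J h c : ℝ}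
    (hJ : 0 ≤ J) (hh : 0 ≤ h) (hiso : h ≤ J * isoperimetricNumber G)
    (hcut : ∀ A : Finset (Fin n), A.card = n / 2 → c * n ≤ (edgeBoundary G A).ncard) :
    (((2 * J * c - h) * n : ℝ) : EReal)
      ≤ stabilityLevel (hamiltonian G (I.coupling r J) h) (allMinus n) := by
  have hlow : ∀ σ : Config n, 2 * J * (edgeBoundary G (plusSet σ)).ncard
      - 2 * h * ((plusSet σ).card : ℝ) ≤ hamiltonian G (I.coupling r J) h σ
        - hamiltonian G (I.coupling r J) h (allMinus n) := fun σ => by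
    have := mul_ncard_edgeBoundary_le G (I.coupling_nonneg r hJ) (plusSet σ)
    rw [I.coupling_one] at this
    rw [hamiltonian_sub_allMinus]
    linarith
  refine le_stabilityLevel fun η hη ω => ?_
  -- With at most `n / 2` pluses the boundary cost `2J|∂A|` already outweighs the field gain
  -- `2h|A|`.
  have hbig : n < 2 * (plusSet η).card := by
    by_contra hcon
    have h1 := isoperimetricNumber_mul_card_le G (not_lt.1 hcon)
    have h2 := hlow η
    have h3 := mul_le_mul_of_nonneg_left h1 hJ
    have h4 := mul_le_mul_of_nonneg_right hiso (Nat.cast_nonneg (α := ℝ) (plusSet η).card)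
    linarith
  obtain ⟨ζ, hζ, hcard⟩ := exists_mem_support_card_plusSet (m := n / 2) ω
    (by simp [plusSet_allMinus]) (by omega)
  refine ⟨ζ, hζ, le_trans ?_ (hlow ζ)⟩
  have h1 := mul_le_mul_of_nonneg_left (hcut _ hcard) hJ
  have h2 : 2 * ((plusSet ζ).card : ℝ) ≤ n := by
    rw [hcard]; exact_mod_cast Nat.mul_div_le n 2
  have h3 := mul_le_mul_of_nonneg_left h2 hh
  linarith

/-- If all row sums of the coupling matrix are bounded by `S`, then the energy barrier is at
most `S * n`. -/
lemma stabilityLevel_allMinus_le {n : ℕ} (hn : 0 < n) {G : SimpleGraph (Fin n)} {K : ℕ → ℝ}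
    {h S : ℝ} (hK : ∀ i, 0 ≤ K i) (hh : 0 < h)
    (hS : ∀ x, ∑ y ∈ {x}ᶜ, K (G.dist x y) ≤ S) :
    stabilityLevel (hamiltonian G K h) (allMinus n) ≤ ((S * n : ℝ) : EReal) := by
  classical
  have hS0 : 0 ≤ S := (Finset.sum_nonneg fun y _ => hK _).trans (hS ⟨0, hn⟩)
  refine stabilityLevel_le (η := fun _ => 1) ?_ fun ζ => ?_
  · have := hamiltonian_sub_allMinus G K h (fun _ => 1)
    have huniv : plusSet (fun _ : Fin n => (1 : ℤˣ)) = Finset.univ := by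
      ext; simp [mem_plusSet]
    rw [huniv] at this
    simp only [Finset.compl_univ, Finset.sum_empty, Finset.sum_const_zero, Finset.card_univ,
      Fintype.card_fin] at this
    have hpos : 0 < h * n := mul_pos hh (by exact_mod_cast hn)
    linarith
  · rw [hamiltonian_sub_allMinus]
    set A := plusSet ζ
    -- Applied to `A` and to `Aᶜ`: the two bounds on the same cross sum add up to `n * S`, which
    -- absorbs the factor 2 in the energy.
    have hrow : ∀ B : Finset (Fin n), ∑ x ∈ B, ∑ y ∈ Bᶜ, K (G.dist x y) ≤ B.card * S := by
      intro B
      rw [← nsmul_eq_mul, ← Finset.sum_const]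
      refine Finset.sum_le_sum fun x hx => le_trans ?_ (hS x)
      refine Finset.sum_le_sum_of_subset_of_nonneg ?_ fun y _ _ => hK _
      intro y hy
      simp only [Finset.mem_compl, Finset.mem_singleton] at hy ⊢
      rintro rfl
      exact hy hx
    have h1 := hrow A
    have h2 := hrow Aᶜ
    rw [compl_compl, Finset.sum_comm] at h2
    simp only [G.dist_comm] at h2
    have h2' : ∑ x ∈ A, ∑ y ∈ Aᶜ, K (G.dist x y) ≤ (Aᶜ).card * S := by
      refine le_trans (le_of_eq ?_) h2
      exact Finset.sum_congr rfl fun x _ => Finset.sum_congr rfl fun y _ => by rw [G.dist_comm]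
    have hc : (A.card : ℝ) + (Aᶜ).card = n := by
      exact_mod_cast (Finset.card_add_card_compl A).trans (Fintype.card_fin n)
    have h3 : 0 ≤ h * (A.card : ℝ) := by positivity
    have h4 : (A.card : ℝ) * S + (Aᶜ).card * S = n * S := by rw [← add_mul, hc]
    linarith

/-! ### Spheres in regular graphs and row sums of the coupling matrix -/

lemma SimpleGraph.Connected.exists_adj_dist_eq {V : Type*} {G : SimpleGraph V}
    (hG : G.Connected) {x z : V} {k : ℕ} (h : G.dist x z = k + 1) :
    ∃ y, G.Adj z y ∧ G.dist x y = k := by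
  obtain ⟨p, hp⟩ := hG.exists_walk_length_eq_dist z x
  rw [G.dist_comm, h] at hp
  cases p with
  | nil => simp at hp
  | @cons _ y _ hzy q =>
    refine ⟨y, hzy, le_antisymm ?_ ?_⟩
    · rw [G.dist_comm]
      refine (SimpleGraph.dist_le q).trans ?_
      rw [SimpleGraph.Walk.length_cons] at hp
      omega
    · have h1 := hG.dist_triangle (u := x) (v := y) (w := z)
      rw [SimpleGraph.dist_eq_one_iff_adj.2 hzy.symm] at h1
      omega

lemma card_filter_adj_of_mem_regularGraphs {n r : ℕ} {G : SimpleGraph (Fin n)}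
    [DecidableRel G.Adj] (hG : G ∈ regularGraphs n r) (x : Fin n) :
    (Finset.univ.filter fun y => G.Adj x y).card = r := by
  rw [← hG x, ← Set.ncard_coe_finset]
  congr 1
  ext y
  simp

/-- Every vertex at positive distance has a neighbour one step closer to `x`, which leaves at most
`r - 1` edges leading outwards. -/
lemma card_sphere_le {n r : ℕ} {G : SimpleGraph (Fin n)} (hG : G ∈ regularGraphs n r)
    (hc : G.Connected) (x : Fin n) (i : ℕ) :
    (Finset.univ.filter fun y => G.dist x y = i + 1).card ≤ r * (r - 1) ^ i := by
  classical
  induction i with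
  | zero =>
    rw [pow_zero, mul_one]
    refine (Finset.card_le_card fun y hy => ?_).trans
      (card_filter_adj_of_mem_regularGraphs hG x).le
    simp only [Finset.mem_filter, Finset.mem_univ, true_and, zero_add] at hy ⊢
    exact SimpleGraph.dist_eq_one_iff_adj.1 hy
  | succ i ih =>
    rw [pow_succ, ← mul_assoc]
    have hsub : (Finset.univ.filter fun z => G.dist x z = i + 1 + 1) ⊆
        (Finset.univ.filter fun y => G.dist x y = i + 1).biUnion fun y =>
          Finset.univ.filter fun z => G.Adj y z ∧ G.dist x z = i + 1 + 1 := by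
      intro z hz
      simp only [Finset.mem_filter, Finset.mem_univ, true_and, Finset.mem_biUnion] at hz ⊢
      obtain ⟨y, hzy, hy⟩ := hc.exists_adj_dist_eq hz
      exact ⟨y, hy, hzy.symm, hz⟩
    refine (Finset.card_le_card hsub).trans ((Finset.card_biUnion_le_card_mul _ _ (r - 1)
      fun y hy => ?_).trans (Nat.mul_le_mul_right _ ih))
    simp only [Finset.mem_filter, Finset.mem_univ, true_and] at hy
    obtain ⟨w, hyw, hw⟩ := hc.exists_adj_dist_eq hy
    have hcard : ((Finset.univ.filter fun z => G.Adj y z).erase w).card = r - 1 := by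
      rw [Finset.card_erase_of_mem (by simpa using hyw),
        card_filter_adj_of_mem_regularGraphs hG y]
    rw [← hcard]
    refine Finset.card_le_card fun z hz => ?_
    simp only [Finset.mem_filter, Finset.mem_univ, true_and] at hz
    simp only [Finset.mem_erase, Finset.mem_filter, Finset.mem_univ, true_and]
    refine ⟨?_, hz.1⟩
    rintro rfl
    omega

lemma SimpleGraph.Connected.dist_le_diam_of_fin {n : ℕ} {G : SimpleGraph (Fin n)}
    (hc : G.Connected) (x y : Fin n) : G.dist x y ≤ G.diam := by
  have : Nonempty (Fin n) := ⟨x⟩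
  exact SimpleGraph.dist_le_diam (SimpleGraph.connected_iff_ediam_ne_top.1 hc)

lemma sum_coupling_dist_le {n r : ℕ} (hr : 1 ≤ r) {G : SimpleGraph (Fin n)}
    (hG : G ∈ regularGraphs n r) (hc : G.Connected) {K : ℕ → ℝ} (hK : ∀ i, 0 ≤ K i)
    (x : Fin n) :
    ∑ y ∈ {x}ᶜ, K (G.dist x y)
      ≤ ∑ i ∈ Finset.range G.diam, (r : ℝ) * ((r : ℝ) - 1) ^ i * K (i + 1) := by
  classical
  have hpos : ∀ y ∈ ({x}ᶜ : Finset (Fin n)), 0 < G.dist x y := fun y hy =>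
    hc.pos_dist_of_ne (by simpa [eq_comm] using hy)
  -- Spheres are indexed by distance minus one; the subtraction is not truncated since `y ≠ x` and
  -- `G` is connected.
  rw [← Finset.sum_fiberwise_of_maps_to (t := Finset.range G.diam)
    (g := fun y => G.dist x y - 1)]
  · refine Finset.sum_le_sum fun i _ => ?_
    have hsub : ∀ y ∈ ({x}ᶜ : Finset (Fin n)).filter (fun y => G.dist x y - 1 = i),
        G.dist x y = i + 1 := fun y hy => by
      rw [Finset.mem_filter] at hy
      have := hpos y hy.1
      omega
    rw [Finset.sum_congr rfl fun y hy => by rw [hsub y hy], Finset.sum_const, nsmul_eq_mul]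
    refine mul_le_mul_of_nonneg_right ?_ (hK _)
    have h1 : (({x}ᶜ : Finset (Fin n)).filter (fun y => G.dist x y - 1 = i)).card
        ≤ r * (r - 1) ^ i := by
      refine (Finset.card_le_card fun y hy => ?_).trans (card_sphere_le hG hc x i)
      simpa using hsub y hy
    have h2 : ((r - 1 : ℕ) : ℝ) = (r : ℝ) - 1 := by push_cast [hr]; ring
    rw [← h2]
    exact_mod_cast h1
  · intro y hy
    have := hpos y hy
    have := hc.dist_le_diam_of_fin x y
    rw [Finset.mem_range]
    omega

/-- For constant coupling 1 the row sum is `n - 1`, while the sphere bound depends only on `r` and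
the diameter. -/
lemma eventually_le_diam {r : ℕ} (hr : 1 ≤ r) (D : ℕ) :
    ∀ᶠ n : ℕ in Filter.atTop, ∀ G ∈ regularGraphs n r, G.Connected → D ≤ G.diam := by
  obtain ⟨N, hN⟩ := exists_nat_gt (1 + ∑ i ∈ Finset.range D, (r : ℝ) * ((r : ℝ) - 1) ^ i)
  filter_upwards [Filter.eventually_ge_atTop N] with n hn G hG hc
  by_contra! hlt
  obtain ⟨x⟩ := hc.nonempty
  have h1 := sum_coupling_dist_le hr hG hc (K := fun _ => 1) (fun _ => zero_le_one) x
  simp only [Finset.sum_const, nsmul_eq_mul, mul_one, Finset.card_compl, Fintype.card_fin,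
    Finset.card_singleton] at h1
  have hr' : (0 : ℝ) ≤ (r : ℝ) - 1 := by
    rw [sub_nonneg]; exact_mod_cast hr
  have h2 : ∑ i ∈ Finset.range G.diam, (r : ℝ) * ((r : ℝ) - 1) ^ i
      ≤ ∑ i ∈ Finset.range D, (r : ℝ) * ((r : ℝ) - 1) ^ i :=
    Finset.sum_le_sum_of_subset_of_nonneg (Finset.range_mono hlt.le) fun i _ _ => by positivity
  have hn1 : 1 ≤ n := x.pos
  push_cast [hn1] at h1
  have h3 : (N : ℝ) ≤ n := by exact_mod_cast hn
  linarith

/-! ### Row sums in the three regimes of the interaction. -/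

lemma sum_exponential_coupling_le {r : ℕ} (hr : 1 ≤ r) {J : ℝ} (hJ : 0 ≤ J) (d : ℕ) :
    ∑ i ∈ Finset.range d,
        (r : ℝ) * ((r : ℝ) - 1) ^ i * Interaction.exponential.coupling r J (i + 1)
      ≤ J * (r * r) := by
  have hr0 : (0 : ℝ) < r := by exact_mod_cast hr
  -- Sphere growth against decay gives a geometric series of ratio `q`, with sum at most `1 / (1 -
  -- q) = r`.
  set q : ℝ := ((r : ℝ) - 1) / r with hq
  have hq0 : 0 ≤ q := div_nonneg (sub_nonneg.2 (by exact_mod_cast hr)) hr0.le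
  have hterm : ∀ i ∈ Finset.range d,
      (r : ℝ) * ((r : ℝ) - 1) ^ i * Interaction.exponential.coupling r J (i + 1)
        = J * r * q ^ i := fun i _ => by
    have : (1 : ℤ) - ((i + 1 : ℕ) : ℤ) = -(i : ℤ) := by push_cast; ring
    rw [Interaction.coupling, this, zpow_neg, zpow_natCast, hq, div_pow]
    field_simp
  rw [Finset.sum_congr rfl hterm, ← Finset.mul_sum]
  have h1 := geom_sum_mul_neg q d
  have h2 : 1 - q = 1 / r := by rw [hq]; field_simp; ring
  have h3 : ∑ i ∈ Finset.range d, q ^ i ≤ r := by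
    rw [h2, mul_one_div, div_eq_iff hr0.ne'] at h1
    rw [h1]
    have : 0 ≤ q ^ d := by positivity
    nlinarith
  calc J * r * ∑ i ∈ Finset.range d, q ^ i ≤ J * r * r := by gcongr
    _ = J * (r * r) := by ring

lemma sum_rpow_neg_le_riemannZeta {lam : ℝ} (h : 1 < lam) (d : ℕ) :
    ∑ i ∈ Finset.range d, ((i + 1 : ℕ) : ℝ) ^ (-lam) ≤ (riemannZeta (lam : ℂ)).re := by
  have hz := zeta_eq_tsum_one_div_nat_add_one_cpow (s := (lam : ℂ)) (by simpa using h)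
  have hs : Summable fun n : ℕ => ((n + 1 : ℕ) : ℝ) ^ (-lam) :=
    (summable_nat_add_iff 1).2 (Real.summable_nat_rpow.2 (by linarith))
  have hterm : ∀ n : ℕ, 1 / ((n : ℂ) + 1) ^ (lam : ℂ) = ((((n + 1 : ℕ) : ℝ) ^ (-lam) : ℝ) : ℂ) :=
    fun n => by
      rw [Complex.ofReal_cpow (by positivity), Complex.ofReal_neg, Complex.cpow_neg, one_div]
      push_cast
      rfl
  rw [hz, tsum_congr hterm, ← Complex.ofReal_tsum, Complex.ofReal_re]
  exact hs.sum_le_tsum _ fun i _ => by positivity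

lemma sum_polynomial_coupling_le_riemannZeta {r : ℕ} (hr : 2 ≤ r) {J lam : ℝ} (hJ : 0 ≤ J)
    (hlam : 1 < lam) (d : ℕ) :
    ∑ i ∈ Finset.range d,
        (r : ℝ) * ((r : ℝ) - 1) ^ i * (Interaction.polynomial lam).coupling r J (i + 1)
      ≤ J * (r * ((riemannZeta (lam : ℂ)).re * ((r : ℝ) - 1) ^ d)) := by
  have hr1 : (1 : ℝ) ≤ (r : ℝ) - 1 := by
    have : (2 : ℝ) ≤ r := by exact_mod_cast hr
    linarith
  calc _ ≤ ∑ i ∈ Finset.range d,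
        J * (r * ((r : ℝ) - 1) ^ d) * ((i + 1 : ℕ) : ℝ) ^ (-lam) := by
        refine Finset.sum_le_sum fun i hi => ?_
        have h1 : ((r : ℝ) - 1) ^ i ≤ ((r : ℝ) - 1) ^ d :=
          pow_le_pow_right₀ hr1 (Finset.mem_range.1 hi).le
        rw [Interaction.coupling]
        calc _ ≤ (r : ℝ) * ((r : ℝ) - 1) ^ d * (J * ((i + 1 : ℕ) : ℝ) ^ (-lam)) := by gcongr
          _ = _ := by ring
    _ ≤ J * (r * ((r : ℝ) - 1) ^ d) * (riemannZeta (lam : ℂ)).re := by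
        rw [← Finset.mul_sum]
        have := sum_rpow_neg_le_riemannZeta hlam d
        gcongr
    _ = _ := by ring

/-- Bounds `r^j / j^d` by `r^(2r) / 2^d`, uniformly in `j`. For `j ≤ 2r` compare factor by factor;
for larger `j`, `r^j * 2^d ≤ (2r)^d ≤ j^d`. -/
lemma pow_mul_two_pow_le {r d j : ℕ} (hr : 1 ≤ r) (hj : 2 ≤ j) (hjd : j ≤ d) :
    r ^ j * 2 ^ d ≤ r ^ (2 * r) * j ^ d := by
  rcases le_total j (2 * r) with h | h
  · exact Nat.mul_le_mul (Nat.pow_le_pow_right hr h) (Nat.pow_le_pow_left hj d)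
  · calc r ^ j * 2 ^ d ≤ r ^ d * 2 ^ d := Nat.mul_le_mul_right _ (Nat.pow_le_pow_right hr hjd)
      _ = (2 * r) ^ d := by rw [mul_pow, mul_comm]
      _ ≤ j ^ d := Nat.pow_le_pow_left h d
      _ ≤ r ^ (2 * r) * j ^ d := Nat.le_mul_of_pos_left _ (by positivity)

/-- Nearest neighbours contribute `J * r`. Each of the fewer than `d` further spheres contributes at
most `J * r^(2r) / 2^d`, so together they are eventually below `J`, uniformly in `lam ≥ d`. -/
lemma eventually_sum_polynomial_coupling_le {r : ℕ} (hr : 1 ≤ r) :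
    ∀ᶠ d : ℕ in Filter.atTop, ∀ J lam : ℝ, 0 ≤ J → (d : ℝ) ≤ lam →
      ∑ i ∈ Finset.range d,
        (r : ℝ) * ((r : ℝ) - 1) ^ i * (Interaction.polynomial lam).coupling r J (i + 1)
      ≤ J * (r + 1) := by
  have hlim : Filter.Tendsto (fun d : ℕ => (r : ℝ) ^ (2 * r) * ((d : ℝ) ^ 1 / 2 ^ d))
      Filter.atTop (nhds ((r : ℝ) ^ (2 * r) * 0)) :=
    (tendsto_pow_const_div_const_pow_of_one_lt 1 one_lt_two).const_mul _
  rw [mul_zero] at hlim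
  have hr0 : (0 : ℝ) ≤ (r : ℝ) - 1 := sub_nonneg.2 (by exact_mod_cast hr)
  filter_upwards [hlim.eventually_le_const zero_lt_one, Filter.eventually_ge_atTop 1]
    with d hd hd1 J lam hJ hlam
  obtain ⟨e, rfl⟩ : ∃ e, d = e + 1 := ⟨d - 1, by omega⟩
  rw [Finset.sum_range_succ']
  have hterm : ∀ i ∈ Finset.range e, (r : ℝ) * ((r : ℝ) - 1) ^ (i + 1)
      * (Interaction.polynomial lam).coupling r J (i + 1 + 1)
        ≤ J * ((r : ℝ) ^ (2 * r) / 2 ^ (e + 1)) := fun i hi => by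
    have hi' := Finset.mem_range.1 hi
    have hnat : (r : ℝ) ^ (i + 2) * 2 ^ (e + 1)
        ≤ (r : ℝ) ^ (2 * r) * ((i + 1 + 1 : ℕ) : ℝ) ^ (e + 1) := by
      exact_mod_cast pow_mul_two_pow_le (d := e + 1) (j := i + 2) hr (by omega) (by omega)
    have h1 : ((i + 1 + 1 : ℕ) : ℝ) ^ (-lam) ≤ (((i + 1 + 1 : ℕ) : ℝ) ^ (e + 1))⁻¹ := by
      rw [Real.rpow_neg (by positivity), ← Real.rpow_natCast]
      gcongr
      · push_cast; linarith [(i.cast_nonneg : (0 : ℝ) ≤ i)]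
    have h2 : (r : ℝ) * ((r : ℝ) - 1) ^ (i + 1) ≤ (r : ℝ) ^ (i + 2) := by
      rw [pow_succ' (r : ℝ) (i + 1)]
      gcongr
      linarith
    rw [Interaction.coupling]
    calc _ ≤ (r : ℝ) ^ (i + 2) * (J * (((i + 1 + 1 : ℕ) : ℝ) ^ (e + 1))⁻¹) := by gcongr
      _ = J * ((r : ℝ) ^ (i + 2) / ((i + 1 + 1 : ℕ) : ℝ) ^ (e + 1)) := by ring
      _ ≤ _ := by
        gcongr J * ?_
        rw [div_le_div_iff₀ (by positivity) (by positivity)]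
        exact hnat
  have hsum := Finset.sum_le_sum hterm
  rw [Finset.sum_const, Finset.card_range, nsmul_eq_mul] at hsum
  have h3 : (e : ℝ) * (J * ((r : ℝ) ^ (2 * r) / 2 ^ (e + 1))) ≤ J * 1 := by
    calc (e : ℝ) * (J * ((r : ℝ) ^ (2 * r) / 2 ^ (e + 1)))
        ≤ ((e + 1 : ℕ) : ℝ) * (J * ((r : ℝ) ^ (2 * r) / 2 ^ (e + 1))) := by
          gcongr; omega
      _ = J * ((r : ℝ) ^ (2 * r) * (((e + 1 : ℕ) : ℝ) ^ 1 / 2 ^ (e + 1))) := by ring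
      _ ≤ J * 1 := by gcongr
  have h4 : (r : ℝ) * ((r : ℝ) - 1) ^ 0 * (Interaction.polynomial lam).coupling r J (0 + 1)
      = J * r := by
    rw [zero_add, Interaction.coupling_one]; ring
  rw [h4]
  linarith

/-- The upper bound on the energy barrier holds for all large regular graphs. -/
lemma eventually_stabilityLevel_allMinus_le {r : ℕ} (hr : 3 ≤ r) :
    ∀ᶠ n : ℕ in Filter.atTop, ∀ G ∈ regularGraphs n r,
      ∀ (I : Interaction) (J h : ℝ), I.Admissible → ParameterCondition G r J h →
        stabilityLevel (hamiltonian G (I.coupling r J) h) (allMinus n)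
          ≤ ((J * ((r : ℝ) * I.barrierFactor r G.diam + 1) * (n : ℝ) : ℝ) : EReal) := by
  obtain ⟨D, hD⟩ := Filter.eventually_atTop.1
    (eventually_sum_polynomial_coupling_le (r := r) (by omega))
  filter_upwards [eventually_le_diam (r := r) (by omega) D, Filter.eventually_gt_atTop 0]
    with n hn hn0 G hG I J h hI hp
  have hJ : 0 < J := zero_lt_one.trans_le hp.one_le
  have hiso : 0 < isoperimetricNumber G := pos_of_mul_pos_right
    (hp.field_pos.trans_le hp.field_le) hJ.le
  have hc := connected_of_isoperimetricNumber_pos hn0 hiso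
  refine stabilityLevel_allMinus_le hn0 (I.coupling_nonneg r hJ.le) hp.field_pos fun x =>
    (sum_coupling_dist_le (by omega) hG hc (I.coupling_nonneg r hJ.le) x).trans ?_
  cases I with
  | exponential =>
    refine (sum_exponential_coupling_le (by omega) hJ.le _).trans ?_
    simp only [Interaction.barrierFactor]
    gcongr
    linarith
  | polynomial lam =>
    simp only [Interaction.barrierFactor]
    split_ifs with hlam
    · refine (hD _ (hn G hG hc) J lam hJ.le hlam).trans ?_
      -- `r + 1 ≤ r(r - 2) + 1` needs `r ≥ 3`.
      have hr3 : (3 : ℝ) ≤ r := by exact_mod_cast hr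
      gcongr
      nlinarith
    · have hlam2 : 2 < lam := hI
      refine (sum_polynomial_coupling_le_riemannZeta (by omega) hJ.le (by linarith) _).trans ?_
      gcongr
      linarith

/-! ### Switchings -/

/-- Replace the edges `ab`, `cd` by `ac`, `bd`. -/
def switchEdges {V : Type*} (G : SimpleGraph V) (a b c d : V) : SimpleGraph V :=
  SimpleGraph.fromEdgeSet ((G.edgeSet \ {s(a, b), s(c, d)}) ∪ {s(a, c), s(b, d)})

lemma edgeSet_switchEdges {V : Type*} {G : SimpleGraph V} {a b c d : V} (hac : a ≠ c)
    (hbd : b ≠ d) : (switchEdges G a b c d).edgeSet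
      = (G.edgeSet \ {s(a, b), s(c, d)}) ∪ {s(a, c), s(b, d)} := by
  rw [switchEdges, SimpleGraph.edgeSet_fromEdgeSet, sdiff_eq_left, Set.disjoint_left]
  rintro e (he | rfl | rfl) h
  · exact G.not_isDiag_of_mem_edgeSet he.1 h
  · exact hac h
  · exact hbd h

/-- A switching is undone by a switching. As `ac` and `bd` were not edges before, removing them
destroys nothing old; this makes the double counting injective. -/
lemma switchEdges_switchEdges {V : Type*} {G : SimpleGraph V} {a b c d : V}
    (hab : G.Adj a b) (hcd : G.Adj c d) (hac : a ≠ c) (hbd : b ≠ d)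
    (hnac : ¬ G.Adj a c) (hnbd : ¬ G.Adj b d) :
    switchEdges (switchEdges G a b c d) a c b d = G := by
  rw [← SimpleGraph.edgeSet_inj, edgeSet_switchEdges hab.ne hcd.ne, edgeSet_switchEdges hac hbd]
  rw [← SimpleGraph.mem_edgeSet] at hab hcd hnac hnbd
  ext e
  simp only [Set.mem_union, Set.mem_sdiff, Set.mem_insert_iff, Set.mem_singleton_iff]
  constructor
  · rintro (⟨⟨h, -⟩ | h, h'⟩ | rfl | rfl)
    · exact h
    · exact absurd h h'
    · exact hab
    · exact hcd
  · intro h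
    by_cases h1 : e = s(a, b) ∨ e = s(c, d)
    · exact Or.inr h1
    · refine Or.inl ⟨Or.inl ⟨h, h1⟩, ?_⟩
      rintro (rfl | rfl) <;> contradiction

lemma switchEdges_adj {V : Type*} {G : SimpleGraph V} {a b c d x y : V} (hac : a ≠ c)
    (hbd : b ≠ d) : (switchEdges G a b c d).Adj x y ↔
      (G.Adj x y ∧ ¬ ((a = x ∧ b = y ∨ a = y ∧ b = x) ∨ (c = x ∧ d = y ∨ c = y ∧ d = x))) ∨
        (a = x ∧ c = y ∨ a = y ∧ c = x) ∨ (b = x ∧ d = y ∨ b = y ∧ d = x) := by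
  rw [← SimpleGraph.mem_edgeSet, edgeSet_switchEdges hac hbd]
  simp only [Set.mem_union, Set.mem_sdiff, Set.mem_insert_iff, Set.mem_singleton_iff,
    SimpleGraph.mem_edgeSet, Sym2.eq_iff, eq_comm]

/-- Each of the four endpoints exchanges one neighbour for a new one. -/
lemma ncard_neighborSet_switchEdges {V : Type*} {G : SimpleGraph V} {a b c d : V}
    (hab : G.Adj a b) (hcd : G.Adj c d) (hac : a ≠ c) (had : a ≠ d) (hbc : b ≠ c) (hbd : b ≠ d)
    (hnac : ¬ G.Adj a c) (hnbd : ¬ G.Adj b d) (v : V) :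
    ((switchEdges G a b c d).neighborSet v).ncard = (G.neighborSet v).ncard := by
  have hab' := hab.ne
  have hcd' := hcd.ne
  by_cases hva : v = a
  · subst hva
    rw [← Set.ncard_exchange (s := G.neighborSet v) (a := c) (b := b) hnac hab]
    congr 1
    ext y
    simp only [SimpleGraph.mem_neighborSet, switchEdges_adj hac hbd, Set.mem_insert_iff,
      Set.mem_sdiff, Set.mem_singleton_iff]
    grind
  by_cases hvb : v = b
  · subst hvb
    rw [← Set.ncard_exchange (s := G.neighborSet v) (a := d) (b := a) hnbd hab.symm]
    congr 1
    ext y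
    simp only [SimpleGraph.mem_neighborSet, switchEdges_adj hac hbd, Set.mem_insert_iff,
      Set.mem_sdiff, Set.mem_singleton_iff]
    grind
  by_cases hvc : v = c
  · subst hvc
    rw [← Set.ncard_exchange (s := G.neighborSet v) (a := a) (b := d)
      (fun h => hnac h.symm) hcd]
    congr 1
    ext y
    simp only [SimpleGraph.mem_neighborSet, switchEdges_adj hac hbd, Set.mem_insert_iff,
      Set.mem_sdiff, Set.mem_singleton_iff]
    grind
  by_cases hvd : v = d
  · subst hvd
    rw [← Set.ncard_exchange (s := G.neighborSet v) (a := b) (b := c)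
      (fun h => hnbd h.symm) hcd.symm]
    congr 1
    ext y
    simp only [SimpleGraph.mem_neighborSet, switchEdges_adj hac hbd, Set.mem_insert_iff,
      Set.mem_sdiff, Set.mem_singleton_iff]
    grind
  congr 1
  ext y
  simp only [SimpleGraph.mem_neighborSet, switchEdges_adj hac hbd]
  grind

/-! ### Counting edges inside and across a bipartition -/

open Classical in
/-- The ordered adjacent pairs with first entry in `A` and second entry in `B`. -/
noncomputable def adjPairs {n : ℕ} (G : SimpleGraph (Fin n)) (A B : Finset (Fin n)) :
    Finset (Fin n × Fin n) :=
  (A ×ˢ B).filter fun p => G.Adj p.1 p.2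

lemma mem_adjPairs {n : ℕ} {G : SimpleGraph (Fin n)} {A B : Finset (Fin n)}
    {p : Fin n × Fin n} : p ∈ adjPairs G A B ↔ (p.1 ∈ A ∧ p.2 ∈ B) ∧ G.Adj p.1 p.2 := by
  simp [adjPairs]

lemma ncard_edgeBoundary {n : ℕ} (G : SimpleGraph (Fin n)) (A : Finset (Fin n)) :
    (edgeBoundary G A).ncard = (adjPairs G A Aᶜ).card := by
  rw [← Set.ncard_coe_finset]
  congr 1
  ext p
  simp [edgeBoundary, mem_adjPairs, and_assoc]

lemma card_adjPairs_comm {n : ℕ} (G : SimpleGraph (Fin n)) (A B : Finset (Fin n)) :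
    (adjPairs G A B).card = (adjPairs G B A).card := by
  refine Finset.card_bij (fun p _ => p.swap) ?_ ?_ ?_
  · intro p hp
    rw [mem_adjPairs] at hp ⊢
    exact ⟨⟨hp.1.2, hp.1.1⟩, hp.2.symm⟩
  · intro p _ q _ h
    exact Prod.swap_injective h
  · intro p hp
    rw [mem_adjPairs] at hp
    exact ⟨p.swap, mem_adjPairs.2 ⟨⟨hp.1.2, hp.1.1⟩, hp.2.symm⟩, p.swap_swap⟩

lemma card_adjPairs_self_add {n r : ℕ} {G : SimpleGraph (Fin n)} (hG : G ∈ regularGraphs n r)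
    (A : Finset (Fin n)) : (adjPairs G A A).card + (adjPairs G A Aᶜ).card = r * A.card := by
  classical
  have h1 : (adjPairs G A Finset.univ).card = r * A.card := by
    have : adjPairs G A Finset.univ
        = A.biUnion fun x => (Finset.univ.filter fun y => G.Adj x y).map ⟨Prod.mk x,
            Prod.mk_right_injective x⟩ := by
      ext ⟨x, y⟩
      simp [mem_adjPairs]
    rw [this, Finset.card_biUnion]
    · simp only [Finset.card_map, card_filter_adj_of_mem_regularGraphs hG, Finset.sum_const,
        smul_eq_mul, mul_comm]
    · intro x _ y _ hxy
      rw [Function.onFun, Finset.disjoint_left]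
      rintro ⟨u, v⟩ h1 h2
      simp only [Finset.mem_map, Function.Embedding.coeFn_mk, Prod.mk.injEq] at h1 h2
      obtain ⟨_, _, rfl, _⟩ := h1
      obtain ⟨_, _, rfl, _⟩ := h2
      exact hxy rfl
  rw [← h1, ← Finset.card_union_of_disjoint]
  · congr 1
    ext p
    simp only [Finset.mem_union, mem_adjPairs, Finset.mem_compl, Finset.mem_univ]
    tauto
  · rw [Finset.disjoint_left]
    intro p hp hq
    rw [mem_adjPairs] at hp hq
    exact Finset.mem_compl.1 hq.1.2 hp.1.2

open Classical in
/-- The pairs of an ordered edge `ab` inside `A` and an ordered edge `cd` outside `A` that can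
be switched to `ac`, `bd`. -/
noncomputable def switchable {n : ℕ} (G : SimpleGraph (Fin n)) (A : Finset (Fin n)) :
    Finset ((Fin n × Fin n) × (Fin n × Fin n)) :=
  (adjPairs G A A ×ˢ adjPairs G Aᶜ Aᶜ).filter fun p =>
    ¬ G.Adj p.1.1 p.2.1 ∧ ¬ G.Adj p.1.2 p.2.2

/-- A pair that cannot be switched has `ac` or `bd` as a crossing edge; given that edge, each of the
other two endpoints has at most `r` choices. -/
lemma card_adjPairs_mul_le {n r : ℕ} {G : SimpleGraph (Fin n)} (hG : G ∈ regularGraphs n r)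
    (A : Finset (Fin n)) :
    (adjPairs G A A).card * (adjPairs G Aᶜ Aᶜ).card
      ≤ (switchable G A).card + 2 * ((adjPairs G A Aᶜ).card * r ^ 2) := by
  classical
  set T := (adjPairs G A Aᶜ).sigma fun q =>
    (Finset.univ.filter fun y => G.Adj q.1 y) ×ˢ (Finset.univ.filter fun y => G.Adj q.2 y)
    with hT
  have hTcard : T.card = (adjPairs G A Aᶜ).card * r ^ 2 := by
    rw [hT, Finset.card_sigma]
    simp only [Finset.card_product, card_filter_adj_of_mem_regularGraphs hG, Finset.sum_const,
      smul_eq_mul, sq]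
  set S := adjPairs G A A ×ˢ adjPairs G Aᶜ Aᶜ with hS
  have hmem : ∀ p, p ∈ S ↔ ((p.1.1 ∈ A ∧ p.1.2 ∈ A) ∧ G.Adj p.1.1 p.1.2) ∧
      ((p.2.1 ∈ Aᶜ ∧ p.2.2 ∈ Aᶜ) ∧ G.Adj p.2.1 p.2.2) := fun p => by
    rw [hS, Finset.mem_product, mem_adjPairs, mem_adjPairs]
  have h1 : (S.filter fun p => G.Adj p.1.1 p.2.1).card ≤ T.card := by
    refine Finset.card_le_card_of_injOn
      (fun p => ⟨(p.1.1, p.2.1), (p.1.2, p.2.2)⟩) ?_ ?_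
    · intro p hp
      rw [Finset.mem_coe, Finset.mem_filter, hmem] at hp
      simp only [hT, Finset.mem_coe, Finset.mem_sigma, mem_adjPairs, Finset.mem_product,
        Finset.mem_filter, Finset.mem_univ, true_and]
      tauto
    · rintro ⟨⟨a, b⟩, ⟨c, d⟩⟩ _ ⟨⟨a', b'⟩, ⟨c', d'⟩⟩ _ h
      simp at h
      grind
  have h2 : (S.filter fun p => G.Adj p.1.2 p.2.2).card ≤ T.card := by
    refine Finset.card_le_card_of_injOn
      (fun p => ⟨(p.1.2, p.2.2), (p.1.1, p.2.1)⟩) ?_ ?_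
    · intro p hp
      rw [Finset.mem_coe, Finset.mem_filter, hmem] at hp
      simp only [hT, Finset.mem_coe, Finset.mem_sigma, mem_adjPairs, Finset.mem_product,
        Finset.mem_filter, Finset.mem_univ, true_and]
      have := hp.1.1.2.symm
      have := hp.1.2.2.symm
      tauto
    · rintro ⟨⟨a, b⟩, ⟨c, d⟩⟩ _ ⟨⟨a', b'⟩, ⟨c', d'⟩⟩ _ h
      simp at h
      grind
  have hsub : S ⊆ switchable G A ∪ ((S.filter fun p => G.Adj p.1.1 p.2.1) ∪
      (S.filter fun p => G.Adj p.1.2 p.2.2)) := by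
    intro p hp
    simp only [switchable, Finset.mem_union, Finset.mem_filter, ← hS]
    tauto
  have h3 := (Finset.card_le_card hsub).trans (Finset.card_union_le _ _)
  have h4 := Finset.card_union_le (S.filter fun p => G.Adj p.1.1 p.2.1)
    (S.filter fun p => G.Adj p.1.2 p.2.2)
  have h5 : S.card = (adjPairs G A A).card * (adjPairs G Aᶜ Aᶜ).card := Finset.card_product _ _
  omega

open Classical in
/-- The `r`-regular graphs with at most `t` edges between `A` and its complement. -/
noncomputable def regularGraphsCutLE (n r : ℕ) (A : Finset (Fin n)) (t : ℕ) :
    Finset (SimpleGraph (Fin n)) :=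
  Finset.univ.filter fun G => G ∈ regularGraphs n r ∧ (adjPairs G A Aᶜ).card ≤ t

lemma mem_regularGraphsCutLE {n r t : ℕ} {A : Finset (Fin n)} {G : SimpleGraph (Fin n)} :
    G ∈ regularGraphsCutLE n r A t ↔
      G ∈ regularGraphs n r ∧ (adjPairs G A Aᶜ).card ≤ t := by
  simp [regularGraphsCutLE]

lemma mem_switchable {n : ℕ} {G : SimpleGraph (Fin n)} {A : Finset (Fin n)} {a b c d : Fin n} :
    ((a, b), (c, d)) ∈ switchable G A ↔ (((a ∈ A ∧ b ∈ A) ∧ G.Adj a b) ∧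
      ((c ∉ A ∧ d ∉ A) ∧ G.Adj c d)) ∧ ¬ G.Adj a c ∧ ¬ G.Adj b d := by
  simp [switchable, mem_adjPairs]

/-- Double counting of switchings. -/
lemma sum_card_switchable_le {n r : ℕ} (A : Finset (Fin n)) (t : ℕ) :
    ∑ G ∈ regularGraphsCutLE n r A t, (switchable G A).card
      ≤ (regularGraphsCutLE n r A (t + 2)).card * (t + 2) ^ 2 := by
  classical
  have hne : ∀ {x y : Fin n}, x ∈ A → y ∉ A → x ≠ y := fun hx hy h => hy (h ▸ hx)
  calc ∑ G ∈ regularGraphsCutLE n r A t, (switchable G A).card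
      = ((regularGraphsCutLE n r A t).sigma fun G => switchable G A).card :=
        (Finset.card_sigma _ _).symm
    _ ≤ ((regularGraphsCutLE n r A (t + 2)).sigma fun G =>
          adjPairs G A Aᶜ ×ˢ adjPairs G A Aᶜ).card := by
        -- Send a switching to the new graph together with its two new crossing edges; the removed
        -- edges do not cross, so the cut grows by at most 2.
        refine Finset.card_le_card_of_injOn (fun q =>
          ⟨switchEdges q.1 q.2.1.1 q.2.1.2 q.2.2.1 q.2.2.2,
            ((q.2.1.1, q.2.2.1), (q.2.1.2, q.2.2.2))⟩) ?_ ?_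
        · rintro ⟨G, ⟨a, b⟩, ⟨c, d⟩⟩ hq
          rw [Finset.mem_coe, Finset.mem_sigma, mem_regularGraphsCutLE] at hq
          obtain ⟨⟨hreg, hcut⟩, hsw⟩ := hq
          obtain ⟨⟨⟨⟨ha, hb⟩, hab⟩, ⟨hc, hd⟩, hcd⟩, hnac, hnbd⟩ := mem_switchable.1 hsw
          rw [Finset.mem_coe, Finset.mem_sigma, mem_regularGraphsCutLE]
          refine ⟨⟨fun v => ?_, ?_⟩, ?_⟩
          · rw [ncard_neighborSet_switchEdges hab hcd (hne ha hc) (hne ha hd) (hne hb hc)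
              (hne hb hd) hnac hnbd]
            exact hreg v
          · have hsub : adjPairs (switchEdges G a b c d) A Aᶜ
                ⊆ insert (a, c) (insert (b, d) (adjPairs G A Aᶜ)) := by
              rintro ⟨x, y⟩ hxy
              simp only [mem_adjPairs, switchEdges_adj (hne ha hc) (hne hb hd),
                Finset.mem_compl] at hxy
              simp only [Finset.mem_insert, mem_adjPairs, Finset.mem_compl, Prod.mk.injEq]
              grind
            refine (Finset.card_le_card hsub).trans ((Finset.card_insert_le _ _).trans ?_)
            have := Finset.card_insert_le (b, d) (adjPairs G A Aᶜ)
            dsimp only at hcut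
            omega
          · simp only [Finset.mem_product, mem_adjPairs, Finset.mem_compl,
              switchEdges_adj (hne ha hc) (hne hb hd)]
            tauto
        · rintro ⟨G, ⟨a, b⟩, ⟨c, d⟩⟩ hq ⟨G', ⟨a', b'⟩, ⟨c', d'⟩⟩ hq' h
          rw [Finset.mem_coe, Finset.mem_sigma] at hq hq'
          obtain ⟨⟨⟨⟨ha, hb⟩, hab⟩, ⟨hc, hd⟩, hcd⟩, hnac, hnbd⟩ := mem_switchable.1 hq.2
          obtain ⟨⟨⟨⟨ha', hb'⟩, hab'⟩, ⟨hc', hd'⟩, hcd'⟩, hnac', hnbd'⟩ := mem_switchable.1 hq'.2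
          simp only [Sigma.mk.injEq, heq_eq_eq, Prod.mk.injEq] at h
          obtain ⟨hG, ⟨rfl, rfl⟩, rfl, rfl⟩ := h
          have h1 := switchEdges_switchEdges hab hcd (hne ha hc) (hne hb hd) hnac hnbd
          have h2 := switchEdges_switchEdges hab' hcd' (hne ha hc) (hne hb hd) hnac' hnbd'
          rw [hG, h2] at h1
          dsimp only at h1
          rw [h1]
    _ ≤ _ := by
        rw [Finset.card_sigma, ← smul_eq_mul, ← Finset.sum_const]
        refine Finset.sum_le_sum fun G hG => ?_
        rw [Finset.card_product, sq]
        have := (mem_regularGraphsCutLE.1 hG).2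
        exact Nat.mul_le_mul this this

/-! ### Balanced cuts of random regular graphs -/

/-- The main terms leave a gain of at least `u * X^2 / 8`. The parity loss `r / 2` and the
non-switchable pairs cost at most `r^2 * X / 2` each, which `8 * r^2 ≤ u * X` just pays for. -/
lemma one_add_mul_sq_le {u X r t : ℝ} (hu : 0 < u) (hu1 : u < 1) (hr : 1 ≤ r) (ht : 0 ≤ t)
    (hX : 0 < X) (hXr : 8 * r ^ 2 ≤ u * X) (htX : t + 2 ≤ (1 - u) * X / 4) :
    (1 + u) * (t + 2) ^ 2 ≤ ((1 + u) * X / 4 - r / 2) ^ 2 - 2 * t * r ^ 2 := by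
  have h2 : (1 + u) * (t + 2) ^ 2 ≤ (1 + u) * ((1 - u) * X / 4) ^ 2 := by gcongr
  have h3 : 2 * t * r ^ 2 ≤ X / 2 * r ^ 2 := by
    have : 0 ≤ u * X := by positivity
    have : 2 * t ≤ X / 2 := by linarith
    gcongr
  have h4 : X * (8 * r ^ 2) ≤ X * (u * X) := by gcongr
  have h5 : (1 + u) * r * X ≤ 2 * r ^ 2 * X := by
    have : (1 + u) * r ≤ 2 * r * r := by gcongr; linarith
    have : (1 + u) * r ≤ 2 * r ^ 2 := by linarith
    gcongr
  have h6 : 2 * u * X ^ 2 ≤ ((1 + u) * (3 * u - u ^ 2)) * X ^ 2 := by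
    have : 0 ≤ u * (1 - u) * (1 + u) := by
      have := sub_pos.2 hu1
      positivity
    have : 2 * u ≤ (1 + u) * (3 * u - u ^ 2) := by nlinarith
    gcongr
  have h7 : 0 ≤ r ^ 2 := sq_nonneg r
  linarith

lemma one_add_mul_card_regularGraphsCutLE_le {n r t : ℕ} {u : ℝ} {A : Finset (Fin n)}
    (hr : 1 ≤ r) (hu : 0 < u) (hn : 8 * r ≤ u * n) (hA : A.card = n / 2)
    (ht : (t : ℝ) + 2 ≤ (1 - u) * (r * n) / 4) :
    (1 + u) * ((regularGraphsCutLE n r A t).card : ℝ)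
      ≤ ((regularGraphsCutLE n r A (t + 2)).card : ℝ) := by
  classical
  have hr1 : (1 : ℝ) ≤ r := by exact_mod_cast hr
  have ht0 : (0 : ℝ) ≤ t := t.cast_nonneg
  have hn0 : (0 : ℝ) < n := by
    by_contra! hcon
    nlinarith
  have hu1 : u < 1 := by
    by_contra! hcon
    have : (1 - u) * (r * n) ≤ 0 := mul_nonpos_of_nonpos_of_nonneg (by linarith) (by positivity)
    linarith
  set X : ℝ := r * n with hX
  have hXr : 8 * (r : ℝ) ^ 2 ≤ u * X := by nlinarith
  have hX0 : 0 < X := by positivity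
  have hA1 : (n : ℝ) - 1 ≤ 2 * A.card := by
    rw [hA, sub_le_iff_le_add]
    exact_mod_cast (by omega : n ≤ 2 * (n / 2) + 1)
  have hA2 : (n : ℝ) ≤ 2 * (Aᶜ).card := by
    rw [Finset.card_compl, Fintype.card_fin, hA]
    exact_mod_cast (by omega : n ≤ 2 * (n - n / 2))
  -- Lower bound for the ordered edges inside either side: degree sum at least `r(n - 1)/2`, minus
  -- at most `(1 - u)rn/4` crossing edges.
  set y : ℝ := (1 + u) * X / 4 - r / 2 with hy
  have hy0 : 0 ≤ y := by nlinarith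
  have hmain : (1 + u) * ((t : ℝ) + 2) ^ 2 ≤ y ^ 2 - 2 * t * r ^ 2 :=
    one_add_mul_sq_le hu hu1 hr1 ht0 hX0 hXr ht
  have hF : ∀ G ∈ regularGraphsCutLE n r A t,
      (1 + u) * ((t : ℝ) + 2) ^ 2 ≤ ((switchable G A).card : ℝ) := by
    intro G hG
    obtain ⟨hreg, hcut⟩ := mem_regularGraphsCutLE.1 hG
    have hk : ((adjPairs G A Aᶜ).card : ℝ) ≤ t := by exact_mod_cast hcut
    have e1 : ((adjPairs G A A).card : ℝ) + (adjPairs G A Aᶜ).card = r * A.card := by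
      exact_mod_cast card_adjPairs_self_add hreg A
    have e2 : ((adjPairs G Aᶜ Aᶜ).card : ℝ) + (adjPairs G A Aᶜ).card = r * (Aᶜ).card := by
      have := card_adjPairs_self_add hreg Aᶜ
      rw [compl_compl, card_adjPairs_comm G Aᶜ A] at this
      exact_mod_cast this
    have e3 : ((adjPairs G A A).card : ℝ) * (adjPairs G Aᶜ Aᶜ).card
        ≤ (switchable G A).card + 2 * ((adjPairs G A Aᶜ).card * (r : ℝ) ^ 2) := by
      exact_mod_cast card_adjPairs_mul_le hreg A
    have f1 : y ≤ (adjPairs G A A).card := by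
      have := mul_le_mul_of_nonneg_left hA1 (zero_le_one.trans hr1)
      linarith
    have f2 : y ≤ (adjPairs G Aᶜ Aᶜ).card := by
      have := mul_le_mul_of_nonneg_left hA2 (zero_le_one.trans hr1)
      linarith
    have f3 : y ^ 2 ≤ ((adjPairs G A A).card : ℝ) * (adjPairs G Aᶜ Aᶜ).card := by
      rw [sq]; gcongr
    have f4 : ((adjPairs G A Aᶜ).card : ℝ) * (r : ℝ) ^ 2 ≤ t * r ^ 2 := by gcongr
    linarith
  have hsum := Finset.sum_le_sum hF
  rw [Finset.sum_const, nsmul_eq_mul] at hsum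
  have hdc : ∑ G ∈ regularGraphsCutLE n r A t, ((switchable G A).card : ℝ)
      ≤ (regularGraphsCutLE n r A (t + 2)).card * ((t : ℝ) + 2) ^ 2 := by
    exact_mod_cast sum_card_switchable_le A t
  have hpos : 0 < ((t : ℝ) + 2) ^ 2 := by positivity
  refine le_of_mul_le_mul_right ?_ hpos
  linarith

lemma one_add_pow_mul_card_regularGraphsCutLE_le {n r : ℕ} {u : ℝ} {A : Finset (Fin n)}
    (hr : 1 ≤ r) (hu : 0 < u) (hn : 8 * r ≤ u * n) (hA : A.card = n / 2) (t j : ℕ)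
    (ht : (t : ℝ) + 2 * j ≤ (1 - u) * (r * n) / 4) :
    (1 + u) ^ j * ((regularGraphsCutLE n r A t).card : ℝ)
      ≤ ((regularGraphsCutLE n r A (t + 2 * j)).card : ℝ) := by
  induction j with
  | zero => simp
  | succ j ih =>
    push_cast at ht
    have h1 := ih (by linarith)
    have h2 := one_add_mul_card_regularGraphsCutLE_le (t := t + 2 * j) hr hu hn hA
      (by push_cast; linarith)
    calc (1 + u) ^ (j + 1) * ((regularGraphsCutLE n r A t).card : ℝ)
        = (1 + u) * ((1 + u) ^ j * ((regularGraphsCutLE n r A t).card : ℝ)) := by ring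
      _ ≤ (1 + u) * ((regularGraphsCutLE n r A (t + 2 * j)).card : ℝ) := by gcongr
      _ ≤ _ := h2

/-- All balanced bipartitions are crossed by at least `c * n` edges. -/
def HasLargeBalancedCuts {n : ℕ} (G : SimpleGraph (Fin n)) (c : ℝ) : Prop :=
  ∀ A : Finset (Fin n), A.card = n / 2 → c * n ≤ (edgeBoundary G A).ncard

lemma five_pow_mul_ncard_small_cut_le {n r s : ℕ} (hs : 1 ≤ s) (hsr : 2 * s ^ 2 ≤ r)
    (hn : 2 * r * s ≤ n) {A : Finset (Fin n)} (hA : A.card = n / 2) :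
    5 ^ n * ({G | G ∈ regularGraphs n r ∧
        ((edgeBoundary G A).ncard : ℝ) < (r / 4 - 2 * r / s) * n}.ncard : ℝ)
      ≤ ((regularGraphs n r).ncard : ℝ) := by
  classical
  have hs0 : (0 : ℝ) < s := by exact_mod_cast hs
  have hr : 1 ≤ r := by nlinarith
  -- A negative threshold makes the event empty; otherwise the natural floor is faithful.
  by_cases hc : (r / 4 - 2 * r / s : ℝ) * n < 0
  · have : {G | G ∈ regularGraphs n r ∧
        ((edgeBoundary G A).ncard : ℝ) < (r / 4 - 2 * r / s) * n} = ∅ := by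
      refine Set.eq_empty_iff_forall_notMem.2 fun G hG => ?_
      have h1 := hG.2
      have h2 : (0 : ℝ) ≤ (edgeBoundary G A).ncard := Nat.cast_nonneg _
      linarith
    rw [this]
    simp
  rw [not_lt] at hc
  set t := ⌊(r / 4 - 2 * r / s : ℝ) * n⌋₊ with ht
  have htle : (t : ℝ) ≤ (r / 4 - 2 * r / s : ℝ) * n := Nat.floor_le hc
  have hsub : {G | G ∈ regularGraphs n r ∧
        ((edgeBoundary G A).ncard : ℝ) < (r / 4 - 2 * r / s) * n}
      ⊆ (regularGraphsCutLE n r A t : Set (SimpleGraph (Fin n))) := by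
    intro G hG
    rw [Finset.mem_coe, mem_regularGraphsCutLE, ← ncard_edgeBoundary]
    exact ⟨hG.1, Nat.le_floor hG.2.le⟩
  have h1 := Set.ncard_le_ncard hsub (Set.toFinite _)
  rw [Set.ncard_coe_finset] at h1
  -- The gap from `(r/4 - 2r/s)n` up to `(1 - 4/s)rn/4` is `rn/s`; `2s² ≤ r` makes room for `sn`
  -- increments of 2.
  have hj : 2 * (s * n : ℕ) * (s : ℝ) ≤ r * n := by
    have : 2 * (s * n) * s ≤ r * n := by nlinarith
    exact_mod_cast this
  have h2 := one_add_pow_mul_card_regularGraphsCutLE_le (n := n) (r := r) (u := 4 / s) (A := A)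
    hr (by positivity) (by
      rw [div_mul_eq_mul_div, le_div_iff₀ hs0]
      have : (2 * r * s : ℝ) ≤ n := by exact_mod_cast hn
      linarith) hA t (s * n) (by
      have e : (1 - 4 / (s : ℝ)) * (r * n) / 4
        = (r / 4 - 2 * r / s : ℝ) * n + r * n / s := by ring
      have : 2 * ((s * n : ℕ) : ℝ) ≤ r * n / s := by
        rw [le_div_iff₀ hs0]
        exact hj
      rw [e]
      linarith)
  -- Bernoulli: `(1 + 4/s)^s ≥ 5`.
  have h3 : (5 : ℝ) ^ n ≤ (1 + 4 / (s : ℝ)) ^ (s * n) := by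
    rw [pow_mul]
    refine pow_le_pow_left₀ (by norm_num) ?_ n
    have h := one_add_mul_le_pow (a := 4 / (s : ℝ)) (by
      have : 0 ≤ 4 / (s : ℝ) := by positivity
      linarith) s
    have e : (s : ℝ) * (4 / s) = 4 := by field_simp
    linarith
  have h4 : (regularGraphsCutLE n r A (t + 2 * (s * n))).card ≤ (regularGraphs n r).ncard := by
    rw [← Set.ncard_coe_finset]
    refine Set.ncard_le_ncard (fun G hG => ?_) (Set.toFinite _)
    exact (mem_regularGraphsCutLE.1 (Finset.mem_coe.1 hG)).1
  calc _ ≤ (1 + 4 / (s : ℝ)) ^ (s * n) * ((regularGraphsCutLE n r A t).card : ℝ) := by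
        gcongr
    _ ≤ _ := h2
    _ ≤ _ := by exact_mod_cast h4

lemma five_pow_mul_ncard_not_hasLargeBalancedCuts_le {n r s : ℕ} (hs : 1 ≤ s)
    (hsr : 2 * s ^ 2 ≤ r) (hn : 2 * r * s ≤ n) :
    5 ^ n * ({G | G ∈ regularGraphs n r ∧
        ¬ HasLargeBalancedCuts G (r / 4 - 2 * r / s)}.ncard : ℝ)
      ≤ 2 ^ n * ((regularGraphs n r).ncard : ℝ) := by
  classical
  let B : Finset (Fin n) → Set (SimpleGraph (Fin n)) := fun A => {G | G ∈ regularGraphs n r ∧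
    ((edgeBoundary G A).ncard : ℝ) < (r / 4 - 2 * r / s) * n}
  let F : Finset (Finset (Fin n)) := Finset.univ.filter fun A => A.card = n / 2
  have hsub : {G | G ∈ regularGraphs n r ∧ ¬ HasLargeBalancedCuts G (r / 4 - 2 * r / s)}
      ⊆ ⋃ A ∈ F, B A := by
    rintro G ⟨hG, hcut⟩
    simp only [HasLargeBalancedCuts, not_forall, not_le] at hcut
    obtain ⟨A, hA, hlt⟩ := hcut
    simp only [Set.mem_iUnion]
    exact ⟨A, by simp [F, hA], hG, hlt⟩
  have h1 : {G | G ∈ regularGraphs n r ∧ ¬ HasLargeBalancedCuts G (r / 4 - 2 * r / s)}.ncard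
      ≤ ∑ A ∈ F, (B A).ncard :=
    (Set.ncard_le_ncard hsub (Set.toFinite _)).trans (Finset.set_ncard_biUnion_le _ _)
  have hF : (F.card : ℝ) ≤ 2 ^ n := by
    have := Finset.card_le_univ F
    rw [Fintype.card_finset, Fintype.card_fin] at this
    exact_mod_cast this
  calc _ ≤ 5 ^ n * ((∑ A ∈ F, (B A).ncard : ℕ) : ℝ) := by gcongr
    _ = ∑ A ∈ F, 5 ^ n * ((B A).ncard : ℝ) := by rw [Nat.cast_sum, Finset.mul_sum]
    _ ≤ ∑ _A ∈ F, ((regularGraphs n r).ncard : ℝ) := Finset.sum_le_sum fun A hA =>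
        five_pow_mul_ncard_small_cut_le hs hsr hn (Finset.mem_filter.1 hA).2
    _ = F.card * ((regularGraphs n r).ncard : ℝ) := by rw [Finset.sum_const, nsmul_eq_mul]
    _ ≤ _ := by gcongr

/-! ### Existence of regular graphs -/

lemma mem_regularGraphs_circulantGraph {n : ℕ} [NeZero n] {S : Set (Fin n)}
    (h0 : (0 : Fin n) ∉ S) (hneg : ∀ a ∈ S, -a ∈ S) :
    SimpleGraph.circulantGraph S ∈ regularGraphs n S.ncard := by
  intro v
  have : (SimpleGraph.circulantGraph S).neighborSet v = (fun a => v + a) '' S := by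
    ext w
    simp only [SimpleGraph.mem_neighborSet, SimpleGraph.circulantGraph, SimpleGraph.fromRel_adj,
      Set.mem_image]
    constructor
    · rintro ⟨-, h | h⟩
      · exact ⟨w - v, by simpa using hneg _ h, by abel⟩
      · exact ⟨w - v, h, by abel⟩
    · rintro ⟨a, ha, rfl⟩
      refine ⟨fun h => h0 ?_, Or.inr (by simpa using ha)⟩
      rw [left_eq_add] at h
      rwa [← h]
  rw [this, Set.ncard_image_of_injective _ (add_right_injective v)]

/-- Needed so that the probability is not the default value `0 / 0 = 0`. -/
lemma regularGraphs_nonempty {n r : ℕ} (hrn : r + 1 < n) (hev : Even (n * r)) :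
    (regularGraphs n r).Nonempty := by
  classical
  have : NeZero n := ⟨by omega⟩
  have hval : ∀ a : Fin n, a ≠ 0 → ((-a : Fin n) : ℕ) = n - a := fun a ha => by
    rw [Fin.val_neg, if_neg ha]
  -- the residues at distance at most `r / 2` from `0`, and `n / 2` if `r` is odd
  let T : Finset ℕ := (Finset.Icc 1 (r / 2) ∪ Finset.Ico (n - r / 2) n) ∪
    (if Even r then ∅ else {n / 2})
  have hTlt : ∀ m ∈ T, m < n := by
    intro m hm
    simp only [T, Finset.mem_union, Finset.mem_Icc, Finset.mem_Ico] at hm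
    split_ifs at hm <;> simp at hm <;> omega
  have hTcard : T.card = r := by
    have h1 : (Finset.Icc 1 (r / 2) ∪ Finset.Ico (n - r / 2) n).card = 2 * (r / 2) := by
      rw [Finset.card_union_of_disjoint]
      · simp; omega
      · rw [Finset.disjoint_left]
        intro m
        simp only [Finset.mem_Icc, Finset.mem_Ico]
        omega
    by_cases hr : Even r
    · simp only [T, hr, if_true, Finset.union_empty, h1]
      exact Nat.two_mul_div_two_of_even hr
    · simp only [T, hr, if_false]
      rw [Finset.card_union_of_disjoint, h1, Finset.card_singleton]
      · exact Nat.two_mul_div_two_add_one_of_odd (Nat.not_even_iff_odd.1 hr)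
      · simp only [Finset.disjoint_singleton_right, Finset.mem_union, Finset.mem_Icc,
          Finset.mem_Ico]
        have := Nat.two_mul_div_two_add_one_of_odd (Nat.not_even_iff_odd.1 hr)
        omega
  let S : Set (Fin n) := {a | (a : ℕ) ∈ T}
  have hS : S.ncard = r := by
    rw [← hTcard, ← Set.ncard_coe_finset, ← Set.ncard_image_of_injective S Fin.val_injective]
    congr 1
    ext m
    simp only [S, Set.mem_image, Set.mem_ofPred_eq, Finset.mem_coe]
    exact ⟨by rintro ⟨a, ha, rfl⟩; exact ha, fun hm => ⟨⟨m, hTlt m hm⟩, hm, rfl⟩⟩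
  have h0T : 0 ∉ T := by
    simp only [T, Finset.mem_union, Finset.mem_Icc, Finset.mem_Ico]
    split_ifs <;> simp <;> omega
  have h0 : (0 : Fin n) ∉ S := h0T
  refine ⟨SimpleGraph.circulantGraph S, hS ▸ mem_regularGraphs_circulantGraph h0 ?_⟩
  intro a ha
  have ha0 : a ≠ 0 := fun h => h0 (h ▸ ha)
  have hapos : 0 < (a : ℕ) := Nat.pos_of_ne_zero fun h => ha0 (Fin.ext h)
  have halt := a.isLt
  change ((-a : Fin n) : ℕ) ∈ T
  replace ha : (a : ℕ) ∈ T := ha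
  rw [hval a ha0]
  by_cases hr : Even r
  · simp only [T, hr, if_true, Finset.union_empty, Finset.mem_union, Finset.mem_Icc,
      Finset.mem_Ico] at ha ⊢
    omega
  -- For odd `r` the order `n` is even, so the residue `n / 2` is its own negative.
  · have hn : Even n := (Nat.even_mul.1 hev).resolve_right hr
    have := Nat.two_mul_div_two_of_even hn
    simp only [T, hr, if_false, Finset.mem_union, Finset.mem_Icc,
      Finset.mem_Ico, Finset.mem_singleton] at ha ⊢
    omega

/-! ### High probability -/

lemma withHighProbability_of_bound {r : ℕ} {P Q : ∀ n : ℕ, SimpleGraph (Fin n) → Prop}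
    (hQ : ∀ᶠ n : ℕ in Filter.atTop, 5 ^ n * ({G | G ∈ regularGraphs n r ∧ ¬ Q n G}.ncard : ℝ)
      ≤ 2 ^ n * ((regularGraphs n r).ncard : ℝ))
    (hP : ∀ᶠ n : ℕ in Filter.atTop, ∀ G ∈ regularGraphs n r, Q n G → P n G) :
    WithHighProbability r P := by
  have hlim : Filter.Tendsto (fun n : ℕ => 1 - (2 / 5 : ℝ) ^ n)
      (Filter.atTop ⊓ Filter.principal {n : ℕ | Even (n * r)}) (nhds (1 - 0)) :=
    ((tendsto_pow_atTop_nhds_zero_of_lt_one (by norm_num) (by norm_num)).const_sub 1).mono_left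
      inf_le_left
  rw [sub_zero] at hlim
  have hle : ∀ n, {G | G ∈ regularGraphs n r ∧ P n G}.ncard ≤ (regularGraphs n r).ncard :=
    fun n => Set.ncard_le_ncard (fun G hG => hG.1) (Set.toFinite _)
  refine tendsto_of_tendsto_of_tendsto_of_le_of_le' hlim tendsto_const_nhds ?_ ?_
  · rw [Filter.eventually_inf_principal]
    filter_upwards [hQ, hP, Filter.eventually_gt_atTop (r + 1)] with n hQn hPn hn hev
    have hpos : (0 : ℝ) < (regularGraphs n r).ncard := by
      exact_mod_cast (Set.ncard_pos (Set.toFinite _)).2 (regularGraphs_nonempty hn hev)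
    have hsplit : (regularGraphs n r).ncard ≤ {G | G ∈ regularGraphs n r ∧ P n G}.ncard
        + {G | G ∈ regularGraphs n r ∧ ¬ Q n G}.ncard := by
      refine (Set.ncard_le_ncard (fun G hG => ?_) (Set.toFinite _)).trans (Set.ncard_union_le _ _)
      by_cases h : Q n G
      · exact Or.inl ⟨hG, hPn G hG h⟩
      · exact Or.inr ⟨hG, h⟩
    have hsplit' : ((regularGraphs n r).ncard : ℝ)
        ≤ ({G | G ∈ regularGraphs n r ∧ P n G}.ncard : ℝ)
        + ({G | G ∈ regularGraphs n r ∧ ¬ Q n G}.ncard : ℝ) := by exact_mod_cast hsplit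
    have hbad : ({G | G ∈ regularGraphs n r ∧ ¬ Q n G}.ncard : ℝ)
        ≤ (2 / 5) ^ n * ((regularGraphs n r).ncard : ℝ) := by
      rw [div_pow, div_mul_eq_mul_div, le_div_iff₀ (by positivity)]
      linarith
    rw [regularGraphProb, le_div_iff₀ hpos]
    linarith
  · refine Filter.Eventually.of_forall fun n => div_le_one_of_le₀ ?_ (Nat.cast_nonneg _)
    exact_mod_cast hle n

/-! ### The error term of the lower bound -/

/-- The error term of the lower bound. -/
noncomputable def lowerError (r : ℕ) : ℝ := 4 * r / Nat.sqrt (r / 2) + √(r : ℝ)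

lemma tendsto_sqrt_div_two : Filter.Tendsto (fun r : ℕ => ((Nat.sqrt (r / 2) : ℕ) : ℝ))
    Filter.atTop Filter.atTop := by
  refine tendsto_natCast_atTop_atTop.comp (Filter.tendsto_atTop_atTop.2 fun b =>
    ⟨2 * (b * b), fun r hr => Nat.le_sqrt.2 ?_⟩)
  omega

lemma isLittleO_lowerError :
    Asymptotics.IsLittleO Filter.atTop lowerError (fun r : ℕ => (r : ℝ)) := by
  have h1 : Filter.Tendsto (fun r : ℕ => 4 / ((Nat.sqrt (r / 2) : ℕ) : ℝ)) Filter.atTop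
      (nhds 0) := tendsto_sqrt_div_two.const_div_atTop 4
  have h2 : Filter.Tendsto (fun r : ℕ => 1 / √(r : ℝ)) Filter.atTop (nhds 0) :=
    (Real.tendsto_sqrt_atTop.comp tendsto_natCast_atTop_atTop).const_div_atTop 1
  have h3 := h1.add h2
  rw [add_zero] at h3
  refine (Asymptotics.isLittleO_iff_tendsto' ?_).2 (h3.congr' ?_)
  · filter_upwards [Filter.eventually_gt_atTop 0] with r hr h0
    exact absurd (Nat.cast_eq_zero.1 h0) hr.ne'
  · filter_upwards [Filter.eventually_gt_atTop 0] with r hr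
    have hr0 : (0 : ℝ) < r := by exact_mod_cast hr
    have hsq : √(r : ℝ) * √(r : ℝ) = r := Real.mul_self_sqrt hr0.le
    rw [lowerError, add_div]
    congr 1
    · field_simp
    · rw [div_eq_div_iff (Real.sqrt_pos.2 hr0).ne' hr0.ne', hsq, one_mul]

lemma sqrt_three_div_two_sub_sqrt_log_two_le_one : √3 / 2 - √(Real.log 2) ≤ 1 := by
  have h1 : √3 ≤ 2 := Real.sqrt_le_iff.2 ⟨by norm_num, by norm_num⟩
  have h2 := Real.sqrt_nonneg (Real.log 2)
  linarith

/-! ### The energy barrier -/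

theorem mainTheorem1 :
    ∃ εl εu : ℕ → ℝ,
      Asymptotics.IsLittleO Filter.atTop εl (fun r : ℕ => (r : ℝ)) ∧
      Asymptotics.IsLittleO Filter.atTop εu (fun r : ℕ => (r : ℝ)) ∧
      ∀ r : ℕ, 3 ≤ r →
        WithHighProbability r (fun (n : ℕ) (G : SimpleGraph (Fin n)) =>
          ∀ (I : Interaction) (J h : ℝ), I.Admissible → ParameterCondition G r J h →
            (∀ C : ℝ, 0 < C → C < √3 / 2 - √(Real.log 2) → h < J * C * √(r : ℝ) →
              ((J * ((r : ℝ) / 2 - εl r) * (n : ℝ) : ℝ) : EReal)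
                ≤ stabilityLevel (hamiltonian G (I.coupling r J) h) (allMinus n)) ∧
            stabilityLevel (hamiltonian G (I.coupling r J) h) (allMinus n)
              ≤ ((J * ((r : ℝ) * I.barrierFactor r G.diam + εu r) * (n : ℝ) : ℝ) : EReal)) := by
  refine ⟨lowerError, fun _ => 1, isLittleO_lowerError, ?_, fun r hr => ?_⟩
  · exact Asymptotics.isLittleO_const_left.2
      (Or.inr (tendsto_norm_atTop_atTop.comp tendsto_natCast_atTop_atTop))
  -- The largest `s` with `2s² ≤ r`; the loss `4r/s` is then of order `√r`.
  set s := Nat.sqrt (r / 2) with hs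
  have hs1 : 1 ≤ s := Nat.le_sqrt.2 (by omega)
  have hsr : 2 * s ^ 2 ≤ r := by
    have : s ^ 2 ≤ r / 2 := Nat.sqrt_le' (r / 2)
    omega
  refine withHighProbability_of_bound
    (Q := fun n G => HasLargeBalancedCuts G (r / 4 - 2 * r / s)) ?_ ?_
  · filter_upwards [Filter.eventually_ge_atTop (2 * r * s)] with n hn
    exact five_pow_mul_ncard_not_hasLargeBalancedCuts_le hs1 hsr hn
  · filter_upwards [eventually_stabilityLevel_allMinus_le hr] with n hn G hG hcut I J h hI hp
    refine ⟨fun C hC0 hC1 hh => ?_, hn G hG I J h hI hp⟩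
    have hJ : 0 < J := zero_lt_one.trans_le hp.one_le
    refine le_trans (EReal.coe_le_coe_iff.2 ?_)
      (le_stabilityLevel_allMinus hJ.le hp.field_pos.le hp.field_le hcut)
    -- Only `h < J√r` is used; the field then costs at most the `√r` part of `lowerError`.
    have hCle : C ≤ 1 := hC1.le.trans sqrt_three_div_two_sub_sqrt_log_two_le_one
    have h1 : J * C * √(r : ℝ) ≤ J * 1 * √(r : ℝ) := by gcongr
    refine mul_le_mul_of_nonneg_right ?_ n.cast_nonneg
    rw [lowerError, ← hs]
    have e : J * ((r : ℝ) / 2 - (4 * r / s + √(r : ℝ)))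
        = 2 * J * (r / 4 - 2 * r / s) - J * 1 * √(r : ℝ) := by ring
    rw [e]
    linarith
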